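/- Let $n\in\{2,3\}$ and let $\Omega\subset\mathbb{R}^n$ be a bounded domain with Lipschitz boundary. Let $L^\infty_+(\Omega)=\{w\in L^\infty(\Omega):\operatorname{ess\,inf} w>0\}$ and $L^2_\diamond(\partial\Omega)=\{w\in L^2(\partial\Omega):\int_{\partial\Omega}w\,dS=0\}$. For $\gamma\in L^\infty_+(\Omega)$ let $\Lambda(\gamma)\colon L^2_\diamond(\partial\Omega)\to L^2_\diamond(\partial\Omega)$ be the Neumann-to-Dirichlet map $f\mapsto u|_{\partial\Omega}$, where $u\in H^1(\Omega)$ is the weak solution of $\nabla\cdot(\gamma\nabla u)=0$ in $\Omega$, $\nu\cdot\gamma\nabla u=f$ on $\partial\Omega$, whose trace lies in $L^2_\diamond(\partial\Omega)$. Let $\gamma=\gamma_0+\kappa\chi_D$, where $\gamma_0\in\mathscr{C}^\infty(\overline\Omega)\cap L^\infty_+(\Omega)$, $\kappa\in L^\infty_+(\Omega)$, and $D$ is open with $\overline D\subseteq\Omega$; let $\beta>0$ be a constant. Let $\{\Lambda_h(\tilde\gamma)\}_{h>0}$, $\tilde\gamma\in L^\infty_+(\Omega)$, be compact self-adjoint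 operators on $L^2_\diamond(\partial\Omega)$ with $$\|\Lambda(\tilde\gamma)-\Lambda_h(\tilde\gamma)\|\le\omega(h)\,\|\tilde\gamma\|_{L^\infty(\Omega)}\quad\text{for all }h>0,\ \tilde\gamma\in L^\infty_+(\Omega),\qquad \lim_{h\to0}\omega(h)=0,$$ where $\omega$ does not depend on $\tilde\gamma$, and let $\{N^\delta\}_{\delta>0}$ be compact self-adjoint operators on $L^2_\diamond(\partial\Omega)$ with $\|N^\delta\|\le\delta$. For open balls $B\subseteq\Omega$ put $$T(B)=\Lambda(\gamma_0+\beta\chi_B)-\Lambda(\gamma),\quad T_h(B)=\Lambda_h(\gamma_0+\beta\chi_B)-\Lambda_h(\gamma),\quad T_h^\delta(B)=\Lambda_h(\gamma_0+\beta\chi_B)-\big(\Lambda_h(\gamma)+N^\delta\big),$$ and for $a\in\mathbb{R}$ and $S\in\{T,T_h^\delta\}$ let $\mathcal{M}_a(S)$ be the collection of all open balls $B\subseteq\Omega$ with $S(B)+a\,\mathrm{Id}\ge0$ in the sense of semidefiniteness. Suppose that the regularization parameter $\alpha=\alpha(h,\delta)\in\mathbb{R}$ satisfies $$\delta-\alpha(h,\delta)\le\inf_{B\in\mathcal{M}_0(T)}\inf\sigma(T_h(B))\quad\text{for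 all }h,\delta>0,\qquad \lim_{h,\delta\to0}\alpha(h,\delta)=0,$$ where $\sigma$ denotes the spectrum and $\inf\emptyset=+\infty$. Then the set-theoretic limit of $\mathcal{M}_{\alpha(h,\delta)}(T_h^\delta)$ as $h,\delta\to0^+$ exists (its limit superior and limit inferior coincide), and $$\lim_{h,\delta\to0}\mathcal{M}_{\alpha(h,\delta)}(T_h^\delta)=\mathcal{M}_0(T)=\bigcap_{h,\delta>0}\mathcal{M}_{\alpha(h,\delta)}(T_h^\delta).$$ -/

import Mathlib

open MeasureTheory Filter Topology TopologicalSpace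
open scoped ENNReal NNReal ContDiff

noncomputable section

namespace EIT

/-- The Euclidean space `ℝⁿ`. -/
abbrev Euc (n : ℕ) : Type := EuclideanSpace ℝ (Fin n)

variable {n : ℕ}

/-! ### Lipschitz domains and function spaces on the boundary -/

/-- `Ω` is locally on one side of the graph of a Lipschitz function: near every boundary point
there are a unit vector `e` and a Lipschitz function `φ` on the hyperplane `e^⊥` such that `Ω` is
the set of points whose `e`-coordinate exceeds `φ` of the projection to `e^⊥`. -/
def HasLipschitzBoundary (Ω : Set (Euc n)) : Prop :=
  ∀ x ∈ frontier Ω, ∃ (e : Euc n) (K : ℝ≥0) (φ : (Submodule.span ℝ {e})ᗮ → ℝ) (U : Set (Euc n)),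
    ‖e‖ = 1 ∧ LipschitzWith K φ ∧ IsOpen U ∧ x ∈ U ∧
      Ω ∩ U = {y | y ∈ U ∧ φ ((Submodule.span ℝ {e})ᗮ.orthogonalProjectionOnto y) < inner ℝ e y}

/-- A bounded domain (nonempty, open and connected set) with Lipschitz-regular boundary. -/
structure IsLipschitzDomain (Ω : Set (Euc n)) : Prop where
  isOpen : IsOpen Ω
  isConnected : IsConnected Ω
  isBounded : Bornology.IsBounded Ω
  hasLipschitzBoundary : HasLipschitzBoundary Ω

/-- The surface measure on `∂Ω`: the `(n-1)`-dimensional Hausdorff measure, normalized so as to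
agree with Lebesgue measure on hyperplanes, restricted to the boundary. -/
def surfaceMeasure (Ω : Set (Euc n)) : Measure (Euc n) :=
  (Measure.euclideanHausdorffMeasure (n - 1)).restrict (frontier Ω)

/-- The Hilbert space `L²(∂Ω)`. -/
abbrev L2Boundary (Ω : Set (Euc n)) : Type := Lp ℝ 2 (surfaceMeasure Ω)

/-- The closed subspace `L²_⋄(∂Ω)` of all `w ∈ L²(∂Ω)` with `⟨w, 1⟩ = 0`. -/
def L2MeanFree (Ω : Set (Euc n)) : Submodule ℝ (L2Boundary Ω) :=
  (Submodule.span ℝ {w : L2Boundary Ω | w =ᵐ[surfaceMeasure Ω] fun _ => (1 : ℝ)})ᗮ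

instance (Ω : Set (Euc n)) : CompleteSpace (L2MeanFree Ω) :=
  inferInstanceAs (CompleteSpace
    ↥(Submodule.span ℝ {w : L2Boundary Ω | w =ᵐ[surfaceMeasure Ω] fun _ => (1 : ℝ)})ᗮ)

/-- The space of bounded linear operators from `L²_⋄(∂Ω)` to itself. -/
abbrev BoundaryOp (Ω : Set (Euc n)) : Type := L2MeanFree Ω →L[ℝ] L2MeanFree Ω

/-! ### The Sobolev space `H¹(Ω)` and traces -/

/-- `u ∈ H¹(Ω)` with weak gradient `g`. -/
structure MemH1 (Ω : Set (Euc n)) (u : Euc n → ℝ) (g : Euc n → Euc n) : Prop where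
  memLp : MemLp u 2 (volume.restrict Ω)
  memLp_grad : MemLp g 2 (volume.restrict Ω)
  weak_grad : ∀ φ : Euc n → ℝ, ContDiff ℝ ∞ φ → HasCompactSupport φ → tsupport φ ⊆ Ω →
    ∫ x in Ω, u x • gradient φ x = -∫ x in Ω, φ x • g x

/-- `w ∈ L²(∂Ω)` is the trace of `u ∈ H¹(Ω)` (with weak gradient `g`): there are smooth functions
whose restrictions to `Ω` tend to `u` in `H¹(Ω)` and whose restrictions to `∂Ω` tend to `w`
in `L²(∂Ω)`. On a Lipschitz domain this is the graph of the continuous extension of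
`φ ↦ φ|_∂Ω` to `H¹(Ω)`, since the smooth functions on the closure are dense in `H¹(Ω)`. -/
def HasTrace (Ω : Set (Euc n)) (u : Euc n → ℝ) (g : Euc n → Euc n) (w : L2Boundary Ω) : Prop :=
  ∃ φ : ℕ → Euc n → ℝ, (∀ k, ContDiff ℝ ∞ (φ k)) ∧
    Tendsto (fun k => eLpNorm (fun x => φ k x - u x) 2 (volume.restrict Ω)) atTop (𝓝 0) ∧
    Tendsto (fun k => eLpNorm (fun x => gradient (φ k) x - g x) 2 (volume.restrict Ω))
      atTop (𝓝 0) ∧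
    Tendsto (fun k => eLpNorm (fun x => φ k x - w x) 2 (surfaceMeasure Ω)) atTop (𝓝 0)

/-! ### Conductivities -/

/-- The set `L^∞_+(Ω)` of all `w ∈ L^∞(Ω)` with `ess inf w > 0`. -/
def Conductivity (Ω : Set (Euc n)) : Type :=
  {w : Lp ℝ ∞ (volume.restrict Ω) // ∃ c : ℝ, 0 < c ∧ ∀ᵐ x ∂(volume.restrict Ω), c ≤ w x}

namespace Conductivity

variable {Ω : Set (Euc n)}

/-- The positive constant `β` as an element of `L^∞_+(Ω)`. -/
def const (Ω : Set (Euc n)) (β : ℝ) (hβ : 0 < β) : Conductivity Ω :=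
  ⟨(memLp_top_const β : MemLp (fun _ => β) ∞ (volume.restrict Ω)).toLp _, β, hβ, by
    filter_upwards [(memLp_top_const β : MemLp (fun _ => β) ∞ (volume.restrict Ω)).coeFn_toLp]
      with x hx
    exact hx.ge⟩

theorem memLp_perturb (γ₀ η : Conductivity Ω) (S : Opens (Euc n)) :
    MemLp (fun x => γ₀.1 x + (S : Set (Euc n)).indicator η.1 x) ∞ (volume.restrict Ω) :=
  (Lp.memLp γ₀.1).add ((Lp.memLp η.1).indicator S.isOpen.measurableSet)

/-- The conductivity `γ₀ + η χ_S`, where `S` is an open set. -/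
def perturb (γ₀ η : Conductivity Ω) (S : Opens (Euc n)) : Conductivity Ω :=
  ⟨(memLp_perturb γ₀ η S).toLp _, by
    obtain ⟨c, hc, hcγ⟩ := γ₀.2
    obtain ⟨d, hd, hdη⟩ := η.2
    refine ⟨c, hc, ?_⟩
    filter_upwards [(memLp_perturb γ₀ η S).coeFn_toLp, hcγ, hdη] with x hx h1 h2
    rw [hx]
    by_cases hS : x ∈ (S : Set (Euc n))
    · rw [Set.indicator_of_mem hS]
      linarith
    · rw [Set.indicator_of_notMem hS]
      linarith⟩

/-- `γ₀` is of class `C^∞` up to the boundary. -/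
def IsSmooth (γ₀ : Conductivity Ω) : Prop :=
  ∃ G : Euc n → ℝ, ContDiffOn ℝ ∞ G (closure Ω) ∧ γ₀.1 =ᵐ[volume.restrict Ω] G

/-- The norm of a conductivity in `L^∞(Ω)`. -/
def supNorm (γ : Conductivity Ω) : ℝ := ‖γ.1‖

end Conductivity

/-! ### The Neumann-to-Dirichlet map -/

/-- `u ∈ H¹(Ω)`, with weak gradient `g` and trace `w`, is a weak solution of the Neumann problem
`∇·(γ∇u) = 0` in `Ω`, `ν·γ∇u = f` on `∂Ω`. -/
structure IsWeakSolution (Ω : Set (Euc n)) (γ : Conductivity Ω) (f : L2Boundary Ω)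
    (u : Euc n → ℝ) (g : Euc n → Euc n) (w : L2Boundary Ω) : Prop where
  memH1 : MemH1 Ω u g
  hasTrace : HasTrace Ω u g w
  weak_form : ∀ (v : Euc n → ℝ) (gv : Euc n → Euc n) (wv : L2Boundary Ω),
    MemH1 Ω v gv → HasTrace Ω v gv wv →
      ∫ x in Ω, γ.1 x * inner ℝ (g x) (gv x) = inner ℝ f wv

/-- `A` is the operator `f ↦ u|_∂Ω`, where `u` is the weak solution of the Neumann problem with
datum `f` whose trace lies in `L²_⋄(∂Ω)`. -/
def IsNDMap (Ω : Set (Euc n)) (γ : Conductivity Ω) (A : BoundaryOp Ω) : Prop :=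
  ∀ f : L2MeanFree Ω, ∃ (u : Euc n → ℝ) (g : Euc n → Euc n),
    IsWeakSolution Ω γ (f : L2Boundary Ω) u g (A f : L2Boundary Ω)

open Classical in
/-- The Neumann-to-Dirichlet map `Λ(γ)`. On a bounded Lipschitz domain the bounded operator
described by `IsNDMap` exists and is unique (the Neumann problem is well posed). -/
def ndMap (Ω : Set (Euc n)) (γ : Conductivity Ω) : BoundaryOp Ω :=
  if h : ∃ A : BoundaryOp Ω, IsNDMap Ω γ A then h.choose else 0

/-! ### Approximate models, noise and the monotonicity tests -/

/-- A family `Λ_h`, `h > 0`, of compact self-adjoint approximate forward models with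
`‖Λ(γ) - Λ_h(γ)‖ ≤ rate(h) ‖γ‖_∞` for all conductivities `γ`, where `rate(h) → 0` as `h → 0`. -/
structure IsApproximateModel (Ω : Set (Euc n)) (Λh : ℝ → Conductivity Ω → BoundaryOp Ω)
    (rate : ℝ → ℝ) : Prop where
  isCompact : ∀ h, 0 < h → ∀ γ, IsCompactOperator (Λh h γ)
  isSelfAdjoint : ∀ h, 0 < h → ∀ γ, IsSelfAdjoint (Λh h γ)
  norm_sub_le : ∀ h, 0 < h → ∀ γ, ‖ndMap Ω γ - Λh h γ‖ ≤ rate h * γ.supNorm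
  tendsto_zero : Tendsto rate (𝓝[>] 0) (𝓝 0)

/-- A family `N^δ`, `δ > 0`, of compact self-adjoint noise operators with `‖N^δ‖ ≤ δ`. -/
structure IsNoiseModel (Ω : Set (Euc n)) (N : ℝ → BoundaryOp Ω) : Prop where
  isCompact : ∀ δ, 0 < δ → IsCompactOperator (N δ)
  isSelfAdjoint : ∀ δ, 0 < δ → IsSelfAdjoint (N δ)
  norm_le : ∀ δ, 0 < δ → ‖N δ‖ ≤ δ

variable {Ω : Set (Euc n)}

/-- `T(B) = Λ(γ₀ + β χ_B) - Λ(γ)`. -/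
def testOp (γ₀ γ : Conductivity Ω) (β : ℝ) (hβ : 0 < β) (B : Opens (Euc n)) : BoundaryOp Ω :=
  ndMap Ω (γ₀.perturb (.const Ω β hβ) B) - ndMap Ω γ

/-- `T_h(B) = Λ_h(γ₀ + β χ_B) - Λ_h(γ)`. -/
def testOpApprox (Λh : ℝ → Conductivity Ω → BoundaryOp Ω) (γ₀ γ : Conductivity Ω)
    (β : ℝ) (hβ : 0 < β) (h : ℝ) (B : Opens (Euc n)) : BoundaryOp Ω :=
  Λh h (γ₀.perturb (.const Ω β hβ) B) - Λh h γ

/-- `T_h^δ(B) = Λ_h(γ₀ + β χ_B) - Λ_h^δ(γ)` with noisy data `Λ_h^δ(γ) = Λ_h(γ) + N^δ`. -/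
def testOpNoisy (Λh : ℝ → Conductivity Ω → BoundaryOp Ω) (N : ℝ → BoundaryOp Ω)
    (γ₀ γ : Conductivity Ω) (β : ℝ) (hβ : 0 < β) (h δ : ℝ) (B : Opens (Euc n)) : BoundaryOp Ω :=
  Λh h (γ₀.perturb (.const Ω β hβ) B) - (Λh h γ + N δ)

/-- `M_a(T)`: the collection of all open balls `B ⊆ Ω` such that `T(B) + a Id ≥ 0` in the sense of
semidefiniteness. -/
def ballCollection (a : ℝ) (T : Opens (Euc n) → BoundaryOp Ω) : Set (Opens (Euc n)) :=
  {B | (∃ (x : Euc n) (r : ℝ), 0 < r ∧ (B : Set (Euc n)) = Metric.ball x r) ∧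
    (B : Set (Euc n)) ⊆ Ω ∧
    (T B + a • ContinuousLinearMap.id ℝ (L2MeanFree Ω)).IsPositive}

/-- `inf σ(S)`, the infimum of the spectrum of `S`. -/
def infSpec (S : BoundaryOp Ω) : ℝ := sInf (spectrum ℝ S)

/-- The admissibility conditions on the regularization parameter:
`δ - α(h,δ) ≤ inf_{B ∈ M₀} inf σ(T_h(B))` for all `h, δ > 0`, and `α(h,δ) → 0` as `h, δ → 0`.
The outer infimum is taken in the extended reals. -/
structure IsAdmissibleParameter (α : ℝ → ℝ → ℝ) (M₀ : Set (Opens (Euc n)))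
    (Th : ℝ → Opens (Euc n) → BoundaryOp Ω) : Prop where
  le_inf : ∀ h δ, 0 < h → 0 < δ →
    ((δ - α h δ : ℝ) : EReal) ≤ ⨅ B ∈ M₀, ((infSpec (Th h B) : ℝ) : EReal)
  tendsto_zero : Tendsto (fun p : ℝ × ℝ => α p.1 p.2) (𝓝[>] 0 ×ˢ 𝓝[>] 0) (𝓝 0)

/-- The family of sets `F` has the set-theoretic limit `S` along the filter `l`: both its limit
superior `⋂_{A ∈ l} ⋃_{i ∈ A} F i` and its limit inferior `⋃_{A ∈ l} ⋂_{i ∈ A} F i` equal `S`. -/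
def HasSetLimit {ι X : Type*} (F : ι → Set X) (l : Filter ι) (S : Set X) : Prop :=
  limsup F l = S ∧ liminf F l = S

end EIT

end

/-!
The argument is the stability of a semidefiniteness test under norm-small perturbations.

Since `Λ_h(γ̃) → Λ(γ̃)` and `N^δ → 0` in operator norm and `α(h,δ) → 0`, the regularized noisy test
operators `T_h^δ(B) + α(h,δ) Id` tend in norm to `T(B)` as `h, δ → 0`. Positive operators (including
the self-adjointness that semidefiniteness requires) form a closed set, hence a
ball that passes the noisy test frequently along the limit passes the exact one
(`mem_ballCollection_zero_of_frequently`).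

Conversely, a bounded self-adjoint operator `S` satisfies `S ≥ inf σ(S) Id`
(`IsSelfAdjoint.sInf_spectrum_mul_norm_sq_le_inner`), so the admissibility condition on `α` yields
`T_h^δ(B) + α(h,δ) Id ≥ (inf σ(T_h(B)) - δ + α(h,δ)) Id ≥ 0` for every `B` that passes the exact test
and *all* `h, δ > 0` (`ballCollection_zero_subset_ballCollection_noisy`). Both the limit and the
intersection formula follow.
-/

/-! ### The bottom of the spectrum of a self-adjoint operator -/

section HilbertSpace

variable {E : Type*} [NormedAddCommGroup E] [InnerProductSpace ℝ E] [CompleteSpace E]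
  {T : E →L[ℝ] E}

/-- For a bounded self-adjoint operator `T` on a nontrivial real Hilbert space, the spectrum contains
a lower bound of the quadratic form of `T`. It is `‖T‖ - ‖R‖` for the positive operator
`R = ‖T‖ - T`, whose norm is the supremum of its Rayleigh quotient and so lies in its spectrum. -/
theorem IsSelfAdjoint.exists_mem_spectrum_forall_mul_norm_sq_le [Nontrivial E]
    (hT : IsSelfAdjoint T) :
    ∃ m ∈ spectrum ℝ T, ∀ x, m * ‖x‖ ^ 2 ≤ inner ℝ (T x) x := by
  set R : E →L[ℝ] E := algebraMap ℝ (E →L[ℝ] E) ‖T‖ - T with hR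
  have hRx : ∀ x, inner ℝ (R x) x = ‖T‖ * ‖x‖ ^ 2 - inner ℝ (T x) x := fun x => by
    simp [hR, ContinuousLinearMap.algebraMap_apply, inner_sub_left, real_inner_smul_left]
  have hRsa : IsSelfAdjoint R := (IsSelfAdjoint.algebraMap _ (IsSelfAdjoint.all _)).sub hT
  have hTx : ∀ x, inner ℝ (T x) x ≤ ‖T‖ * ‖x‖ ^ 2 := fun x => by
    grw [real_inner_le_norm, T.le_opNorm, sq, mul_assoc]
  have hmem : ‖R‖ ∈ spectrum ℝ R := by
    by_contra hcon
    obtain ⟨ε, hε, hle⟩ := R.rayleighQuotient_le_of_norm_mem_resolventSet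
      (show algebraMap ℝ ℝ ‖R‖ ∈ resolventSet ℝ R from not_not.mp hcon)
    have hnorm := R.norm_eq_iSup_rayleighQuotient hRsa.isSymmetric
    have hsup : ⨆ x, |R.rayleighQuotient x| ≤ ‖R‖ - ε := ciSup_le fun x => by
      rw [abs_of_nonneg]
      · exact hle x
      · refine div_nonneg ?_ (sq_nonneg _)
        rw [ContinuousLinearMap.reApplyInnerSelf_apply, RCLike.re_to_real, hRx]
        linarith [hTx x]
    linarith
  refine ⟨‖T‖ - ‖R‖, ?_, fun x => ?_⟩
  · rw [spectrum.mem_iff] at hmem ⊢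
    rw [IsUnit.sub_iff] at hmem
    convert hmem using 2
    rw [hR, map_sub]
    abel
  · have h1 : inner ℝ (R x) x ≤ ‖R‖ * ‖x‖ ^ 2 := by
      grw [real_inner_le_norm, R.le_opNorm, sq, mul_assoc]
    rw [hRx] at h1
    linarith

/-- A self-adjoint operator is bounded below by the bottom of its spectrum. -/
theorem IsSelfAdjoint.sInf_spectrum_mul_norm_sq_le_inner (hT : IsSelfAdjoint T) (x : E) :
    sInf (spectrum ℝ T) * ‖x‖ ^ 2 ≤ inner ℝ (T x) x := by
  -- On the trivial space the spectrum is empty, but the quadratic form vanishes.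
  rcases subsingleton_or_nontrivial E with h | h
  · simp [Subsingleton.elim x 0]
  obtain ⟨m, hm, hmx⟩ := hT.exists_mem_spectrum_forall_mul_norm_sq_le
  have hle : sInf (spectrum ℝ T) ≤ m := csInf_le (spectrum.isBounded T).bddBelow hm
  grw [hle, hmx x]

/-! ### Positivity under perturbations and limits -/

/-- A perturbation of norm at most `δ` lowers the quadratic form by at most `δ ‖x‖²`, so
`A - C - P + a Id` is positive as soon as `δ - a ≤ inf σ(A - C)`. -/
theorem IsSelfAdjoint.isPositive_sub_add_smul_id {A C P : E →L[ℝ] E} {δ a : ℝ}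
    (hA : IsSelfAdjoint A) (hC : IsSelfAdjoint C) (hP : IsSelfAdjoint P) (hPδ : ‖P‖ ≤ δ)
    (ha : δ - a ≤ sInf (spectrum ℝ (A - C))) :
    (A - (C + P) + a • ContinuousLinearMap.id ℝ E).IsPositive := by
  refine ContinuousLinearMap.isPositive_def'.mpr ⟨?_, fun x => ?_⟩
  · exact (hA.sub (hC.add hP)).add ((IsSelfAdjoint.all a).smul (IsSelfAdjoint.one (E →L[ℝ] E)))
  · have hnoise : inner ℝ (P x) x ≤ δ * ‖x‖ ^ 2 := by
      grw [real_inner_le_norm, P.le_opNorm, hPδ, sq, mul_assoc]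
    have hlow := (hA.sub hC).sInf_spectrum_mul_norm_sq_le_inner x
    have hmul := mul_le_mul_of_nonneg_right ha (sq_nonneg ‖x‖)
    have hform : inner ℝ ((A - (C + P) + a • ContinuousLinearMap.id ℝ E) x) x =
        inner ℝ ((A - C) x) x - inner ℝ (P x) x + a * ‖x‖ ^ 2 := by
      simp [inner_add_left, inner_sub_left, real_inner_smul_left, sub_sub]
    rw [ContinuousLinearMap.reApplyInnerSelf_apply, RCLike.re_to_real, hform]
    linarith

theorem ContinuousLinearMap.isClosed_setOf_isPositive :
    IsClosed {T : E →L[ℝ] E | T.IsPositive} := by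
  simp only [ContinuousLinearMap.isPositive_def', ContinuousLinearMap.reApplyInnerSelf_apply,
    Set.ofPred_and, Set.ofPred_forall]
  refine (isClosed_eq continuous_star continuous_id).inter (isClosed_iInter fun x => ?_)
  exact isClosed_le continuous_const (RCLike.continuous_re.comp
    (((ContinuousLinearMap.apply ℝ E x).continuous).inner continuous_const))

/-- Frequent positivity of `A_i - (C_i + P_i) + a_i Id` passes to the norm limit. -/
theorem ContinuousLinearMap.isPositive_of_frequently_sub_add_smul_id {ι : Type*} {l : Filter ι}
    {A C P : ι → E →L[ℝ] E} {a : ι → ℝ} {A₀ C₀ : E →L[ℝ] E} {r s d : ι → ℝ}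
    (hA : ∀ᶠ i in l, ‖A₀ - A i‖ ≤ r i) (hC : ∀ᶠ i in l, ‖C₀ - C i‖ ≤ s i)
    (hP : ∀ᶠ i in l, ‖P i‖ ≤ d i) (hr : Tendsto r l (𝓝 0)) (hs : Tendsto s l (𝓝 0))
    (hd : Tendsto d l (𝓝 0)) (ha : Tendsto a l (𝓝 0))
    (hpos : ∃ᶠ i in l, (A i - (C i + P i) + a i • ContinuousLinearMap.id ℝ E).IsPositive) :
    (A₀ - C₀).IsPositive := by
  have hA' : Tendsto A l (𝓝 A₀) := tendsto_iff_norm_sub_tendsto_zero.mpr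
    (squeeze_zero' (.of_forall fun _ => norm_nonneg _)
      (hA.mono fun i hi => (norm_sub_rev _ _).trans_le hi) hr)
  have hC' : Tendsto C l (𝓝 C₀) := tendsto_iff_norm_sub_tendsto_zero.mpr
    (squeeze_zero' (.of_forall fun _ => norm_nonneg _)
      (hC.mono fun i hi => (norm_sub_rev _ _).trans_le hi) hs)
  have hP' : Tendsto P l (𝓝 0) := squeeze_zero_norm' hP hd
  have hlim := (hA'.sub (hC'.add hP')).add (ha.smul_const (ContinuousLinearMap.id ℝ E))
  rw [add_zero, zero_smul, add_zero] at hlim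
  exact isClosed_setOf_isPositive.mem_of_frequently_of_tendsto hpos hlim

end HilbertSpace

/-! ### Comparison of the exact and the noisy tests -/

namespace EIT

variable {n : ℕ} {Ω : Set (Euc n)}
variable {Λh : ℝ → Conductivity Ω → BoundaryOp Ω} {rate : ℝ → ℝ} {N : ℝ → BoundaryOp Ω}

/-- Passing the noisy tests frequently as `h, δ → 0` implies passing the exact test. -/
theorem mem_ballCollection_zero_of_frequently (hΛh : IsApproximateModel Ω Λh rate)
    (hN : IsNoiseModel Ω N) {α : ℝ → ℝ → ℝ}
    (hα : Tendsto (fun p : ℝ × ℝ => α p.1 p.2) (𝓝[>] 0 ×ˢ 𝓝[>] 0) (𝓝 0))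
    {γ₀ γ : Conductivity Ω} {β : ℝ} {hβ : 0 < β} {B : Opens (Euc n)}
    (hB : ∃ᶠ p : ℝ × ℝ in 𝓝[>] 0 ×ˢ 𝓝[>] 0,
      B ∈ ballCollection (α p.1 p.2) (testOpNoisy Λh N γ₀ γ β hβ p.1 p.2)) :
    B ∈ ballCollection 0 (testOp γ₀ γ β hβ) := by
  obtain ⟨p, hball, hsub, -⟩ := hB.exists
  refine ⟨hball, hsub, ?_⟩
  have hh : ∀ᶠ p : ℝ × ℝ in 𝓝[>] 0 ×ˢ 𝓝[>] 0, 0 < p.1 := tendsto_fst self_mem_nhdsWithin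
  have hδ : ∀ᶠ p : ℝ × ℝ in 𝓝[>] 0 ×ˢ 𝓝[>] 0, 0 < p.2 := tendsto_snd self_mem_nhdsWithin
  have hrate : ∀ c : ℝ, Tendsto (fun p : ℝ × ℝ => rate p.1 * c) (𝓝[>] 0 ×ˢ 𝓝[>] 0) (𝓝 0) :=
    fun c => by simpa using (hΛh.tendsto_zero.comp tendsto_fst).mul_const c
  have hd : Tendsto (fun p : ℝ × ℝ => p.2) (𝓝[>] 0 ×ˢ 𝓝[>] 0) (𝓝 0) :=
    tendsto_snd.mono_right nhdsWithin_le_nhds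
  have key : (testOp γ₀ γ β hβ B).IsPositive :=
    ContinuousLinearMap.isPositive_of_frequently_sub_add_smul_id
      (A := fun p : ℝ × ℝ => Λh p.1 (γ₀.perturb (.const Ω β hβ) B))
      (C := fun p => Λh p.1 γ) (P := fun p => N p.2)
      (hh.mono fun p hp => hΛh.norm_sub_le p.1 hp _)
      (hh.mono fun p hp => hΛh.norm_sub_le p.1 hp _)
      (hδ.mono fun p hp => hN.norm_le p.2 hp)
      (hrate _) (hrate _) hd hα (hB.mono fun p hp => hp.2.2)
  have hzero : testOp γ₀ γ β hβ B + (0 : ℝ) • ContinuousLinearMap.id ℝ (L2MeanFree Ω) =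
      testOp γ₀ γ β hβ B := by
    ext1 x
    simp only [ContinuousLinearMap.add_apply, ContinuousLinearMap.smul_apply, zero_smul, add_zero]
  rw [hzero]
  exact key

/-- A ball that passes the exact test passes every regularized noisy test. -/
theorem ballCollection_zero_subset_ballCollection_noisy (hΛh : IsApproximateModel Ω Λh rate)
    (hN : IsNoiseModel Ω N) {α : ℝ → ℝ → ℝ} {γ₀ γ : Conductivity Ω} {β : ℝ} {hβ : 0 < β}
    (hα : IsAdmissibleParameter α (ballCollection 0 (testOp γ₀ γ β hβ))
      (testOpApprox Λh γ₀ γ β hβ)) {h δ : ℝ} (hh : 0 < h) (hδ : 0 < δ) :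
    ballCollection 0 (testOp γ₀ γ β hβ) ⊆
      ballCollection (α h δ) (testOpNoisy Λh N γ₀ γ β hβ h δ) := by
  intro B hB
  refine ⟨hB.1, hB.2.1, ?_⟩
  exact IsSelfAdjoint.isPositive_sub_add_smul_id
    (hΛh.isSelfAdjoint h hh (γ₀.perturb (.const Ω β hβ) B)) (hΛh.isSelfAdjoint h hh γ)
    (hN.isSelfAdjoint δ hδ) (hN.norm_le δ hδ)
    (EReal.coe_le_coe_iff.mp ((hα.le_inf h δ hh hδ).trans (iInf₂_le B hB)))

end EIT

theorem corollary3p3 {n : ℕ} (hn : n = 2 ∨ n = 3)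
    {Ω : Set (EIT.Euc n)} (hΩ : EIT.IsLipschitzDomain Ω)
    (γ₀ κ : EIT.Conductivity Ω) (hγ₀ : γ₀.IsSmooth)
    (D : Opens (EIT.Euc n)) (hD : closure (D : Set (EIT.Euc n)) ⊆ Ω)
    (γ : EIT.Conductivity Ω) (hγ : γ = γ₀.perturb κ D)
    (β : ℝ) (hβ : 0 < β)
    (Λh : ℝ → EIT.Conductivity Ω → EIT.BoundaryOp Ω) (rate : ℝ → ℝ)
    (hΛh : EIT.IsApproximateModel Ω Λh rate)
    (N : ℝ → EIT.BoundaryOp Ω) (hN : EIT.IsNoiseModel Ω N)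
    (α : ℝ → ℝ → ℝ)
    (hα : EIT.IsAdmissibleParameter α
      (EIT.ballCollection 0 (EIT.testOp γ₀ γ β hβ))
      (EIT.testOpApprox Λh γ₀ γ β hβ)) :
    EIT.HasSetLimit
        (fun p : ℝ × ℝ =>
          EIT.ballCollection (α p.1 p.2) (EIT.testOpNoisy Λh N γ₀ γ β hβ p.1 p.2))
        (𝓝[>] 0 ×ˢ 𝓝[>] 0)
        (EIT.ballCollection 0 (EIT.testOp γ₀ γ β hβ)) ∧
      EIT.ballCollection 0 (EIT.testOp γ₀ γ β hβ) =
        ⋂ (h : ℝ) (_ : 0 < h) (δ : ℝ) (_ : 0 < δ),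
          EIT.ballCollection (α h δ) (EIT.testOpNoisy Λh N γ₀ γ β hβ h δ) := by
  have hsub : ∀ {h δ : ℝ}, 0 < h → 0 < δ → EIT.ballCollection 0 (EIT.testOp γ₀ γ β hβ) ⊆
      EIT.ballCollection (α h δ) (EIT.testOpNoisy Λh N γ₀ γ β hβ h δ) :=
    EIT.ballCollection_zero_subset_ballCollection_noisy hΛh hN hα
  have hpos : ∀ᶠ p : ℝ × ℝ in 𝓝[>] 0 ×ˢ 𝓝[>] 0, 0 < p.1 ∧ 0 < p.2 :=
    prod_mem_prod self_mem_nhdsWithin self_mem_nhdsWithin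
  have hev : ∀ B ∈ EIT.ballCollection 0 (EIT.testOp γ₀ γ β hβ),
      ∀ᶠ p : ℝ × ℝ in 𝓝[>] 0 ×ˢ 𝓝[>] 0,
        B ∈ EIT.ballCollection (α p.1 p.2) (EIT.testOpNoisy Λh N γ₀ γ β hβ p.1 p.2) :=
    fun B hB => hpos.mono fun p hp => hsub hp.1 hp.2 hB
  refine ⟨⟨?_, ?_⟩, Set.Subset.antisymm ?_ fun B hB => ?_⟩
  · ext B
    rw [mem_limsup_iff_frequently_mem]
    exact ⟨EIT.mem_ballCollection_zero_of_frequently hΛh hN hα.tendsto_zero,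
      fun hB => (hev B hB).frequently⟩
  · ext B
    rw [mem_liminf_iff_eventually_mem]
    exact ⟨fun hB => EIT.mem_ballCollection_zero_of_frequently hΛh hN hα.tendsto_zero
      hB.frequently, hev B⟩
  · exact Set.subset_iInter₂ fun h hh => Set.subset_iInter₂ fun δ hδ => hsub hh hδ
  · refine EIT.mem_ballCollection_zero_of_frequently hΛh hN hα.tendsto_zero
      (hpos.mono fun p hp => ?_).frequently
    simp only [Set.mem_iInter] at hB
    exact hB p.1 hp.1 p.2 hp.2
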